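/- Let $p$ be a prime and let $A=\{a_1<a_2<\dots<a_p\}$ be a set of exactly $p$ non-negative integers (the digits of a $p$-ary number system). An $A$-expansion of an integer $k\ge 0$ is a finite tuple $(\alpha_0,\dots,\alpha_J)$ of elements of $A$ with $k=\sum_{j=0}^{J}\alpha_j p^j$ and $\alpha_J\neq 0$; the empty tuple is an $A$-expansion of $0$. The system $A$ has the uniqueness property if every integer $k\ge 0$ has at most one $A$-expansion. Suppose that $A$ is irreducible, that is, $\gcd(a_2-a_1,\dots,a_p-a_1,p)=1$. Then $A$ has the uniqueness property if and only if $A$ does not contain two distinct numbers that are congruent modulo $p$. -/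

import Mathlib

namespace NumberSystem

/-- An `A`-expansion of `k` in base `n`: a finite tuple `(α₀, …, α_J)` of digits from `A`, written
as a list with the least significant digit first, with `k = ∑ αⱼ n ^ j` and leading digit
`α_J ≠ 0`. The empty tuple is allowed and expands `0`. -/
def IsExpansion (n : ℕ) (A : Finset ℕ) (k : ℕ) (l : List ℕ) : Prop :=
  (∀ d ∈ l, d ∈ A) ∧ (∀ h : l ≠ [], l.getLast h ≠ 0) ∧ k = ∑ j : Fin l.length, l[j] * n ^ (j : ℕ)

/-- The `n`-ary number system `A` has the uniqueness property: every integer `k ≥ 0` has at most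
one `A`-expansion. -/
def HasUniqueness (n : ℕ) (A : Finset ℕ) : Prop :=
  ∀ (k : ℕ) (l l' : List ℕ), IsExpansion n A k l → IsExpansion n A k l' → l = l'

/-- The `n`-ary number system `A = {a₁ < ⋯ < aₘ}` is irreducible:
`gcd (a₂ - a₁, …, aₘ - a₁, n) = 1`. The extra term `a₁ - a₁ = 0` does not change the gcd, and the
natural-number subtraction is exact because `a₁` is the smallest digit. -/
def IsIrreducible (n : ℕ) (A : Finset ℕ) : Prop :=
  ∃ h : A.Nonempty, Nat.gcd (A.gcd fun a => a - A.min' h) n = 1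

end NumberSystem

open Finset

namespace NumberSystem

/-! ### Expansions and words -/

/-! If the digits are distinct modulo `p`, reduction modulo `p` determines the lowest digit, and
induction gives uniqueness.

Conversely, uniqueness makes the `p ^ J` words of length `J` represent distinct integers, so the
exponential sum of their values is a product of values of `expSum A`. If `expSum A` vanished at no
`stdRoot p (l + 1)`, this sum would have size at least `c * p ^ J` at `J` different frequencies,
while Parseval bounds the sum of squares by a constant times `p ^ (2 * J)`: impossible for large `J`
(`HasUniqueness.exists_expSum_eq_zero`). A zero at a root of order `p ^ (l + 1)` splits each class
modulo `p ^ l` evenly into `p` classes modulo `p ^ (l + 1)` (`card_modEq_of_expSum_eq_zero`). With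
only `p` digits, all lie in one class modulo `p ^ l` and are distinct modulo `p ^ (l + 1)`;
irreducibility forces `l = 0`. -/

theorem isExpansion_iff {n : ℕ} {A : Finset ℕ} {k : ℕ} {l : List ℕ} :
    IsExpansion n A k l ↔
      (∀ d ∈ l, d ∈ A) ∧ (∀ h : l ≠ [], l.getLast h ≠ 0) ∧ k = Nat.ofDigits n l := by
  have key : ∀ l : List ℕ, ∑ j : Fin l.length, l[j] * n ^ (j : ℕ) = Nat.ofDigits n l := by
    intro l
    induction l with
    | nil => simp
    | cons d l ih =>
      rw [Nat.ofDigits_cons, ← ih, mul_sum]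
      refine (Fin.sum_univ_succ (n := l.length)
        (fun j => (d :: l)[j] * n ^ (j : ℕ))).trans ?_
      simp only [Fin.getElem_fin, Fin.val_zero, List.getElem_cons_zero, pow_zero, mul_one,
        Fin.val_succ, List.getElem_cons_succ]
      congr 1
      exact sum_congr rfl fun j _ => by ring
  rw [IsExpansion, key]

theorem ofDigits_pos_of_getLast_ne_zero {n : ℕ} (hn : 0 < n) {l : List ℕ} (hl : l ≠ [])
    (h : l.getLast hl ≠ 0) : 0 < Nat.ofDigits n l := by
  induction l with
  | nil => exact absurd rfl hl
  | cons d l ih =>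
    rw [Nat.ofDigits_cons]
    rcases eq_or_ne l [] with rfl | hne
    · simp only [List.getLast_singleton] at h
      simpa using Nat.pos_of_ne_zero h
    · rw [List.getLast_cons hne] at h
      have := Nat.mul_pos hn (ih hne h)
      omega

theorem hasUniqueness_of_not_modEq {n : ℕ} (hn : 0 < n) {A : Finset ℕ}
    (hA : ∀ a ∈ A, ∀ b ∈ A, a ≠ b → ¬ a ≡ b [MOD n]) : HasUniqueness n A := by
  suffices H : ∀ l l' : List ℕ, (∀ d ∈ l, d ∈ A) → (∀ d ∈ l', d ∈ A) →
      (∀ h : l ≠ [], l.getLast h ≠ 0) → (∀ h : l' ≠ [], l'.getLast h ≠ 0) →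
      Nat.ofDigits n l = Nat.ofDigits n l' → l = l' by
    intro k l l' hl hl'
    rw [isExpansion_iff] at hl hl'
    exact H l l' hl.1 hl'.1 hl.2.1 hl'.2.1 (hl.2.2.symm.trans hl'.2.2)
  intro l
  induction l with
  | nil =>
    intro l' _ _ _ h' h
    by_contra hne
    have := ofDigits_pos_of_getLast_ne_zero hn (Ne.symm hne) (h' (Ne.symm hne))
    simp only [Nat.ofDigits_nil] at h
    omega
  | cons d l ih =>
    intro l' hd hd' h h' heq
    cases l' with
    | nil =>
      have := ofDigits_pos_of_getLast_ne_zero hn (List.cons_ne_nil d l) (h (List.cons_ne_nil d l))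
      simp only [Nat.ofDigits_nil] at heq
      omega
    | cons e l' =>
      simp only [Nat.ofDigits_cons] at heq
      have hmod : d ≡ e [MOD n] := by
        have := congrArg (· % n) heq
        simpa [Nat.ModEq, Nat.add_mul_mod_self_left] using this
      have hde : d = e := by
        by_contra hne
        exact hA d (hd d (by simp)) e (hd' e (by simp)) hne hmod
      subst hde
      have htail := Nat.eq_of_mul_eq_mul_left hn (Nat.add_left_cancel heq)
      rw [ih l' (fun x hx => hd x (by simp [hx])) (fun x hx => hd' x (by simp [hx]))
        (fun hne => by simpa [List.getLast_cons hne] using h (List.cons_ne_nil d l))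
        (fun hne => by simpa [List.getLast_cons hne] using h' (List.cons_ne_nil d l')) htail]

theorem exists_eq_append_replicate_zero (l : List ℕ) :
    ∃ m c, l = m ++ List.replicate c 0 ∧ ∀ h : m ≠ [], m.getLast h ≠ 0 := by
  induction l using List.reverseRecOn with
  | nil => exact ⟨[], 0, by simp, by simp⟩
  | append_singleton l d ih =>
    obtain ⟨m, c, rfl, hm⟩ := ih
    rcases eq_or_ne d 0 with rfl | hd
    · exact ⟨m, c + 1, by simp [List.replicate_succ'], hm⟩
    · exact ⟨m ++ List.replicate c 0 ++ [d], 0, by simp, by simpa using hd⟩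

/-- Stripping leading zeros turns both words into genuine expansions; equal lengths then recover the
number of zeros. -/
theorem HasUniqueness.eq_of_length_eq {n : ℕ} {A : Finset ℕ} (hA : HasUniqueness n A)
    {l l' : List ℕ} (hl : ∀ d ∈ l, d ∈ A) (hl' : ∀ d ∈ l', d ∈ A) (hlen : l.length = l'.length)
    (h : Nat.ofDigits n l = Nat.ofDigits n l') : l = l' := by
  obtain ⟨m, c, rfl, hm⟩ := exists_eq_append_replicate_zero l
  obtain ⟨m', c', rfl, hm'⟩ := exists_eq_append_replicate_zero l'
  simp only [Nat.ofDigits_append_replicate_zero] at h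
  have hmm : m = m' := hA (Nat.ofDigits n m) m m'
    (isExpansion_iff.2 ⟨fun d hd => hl d (by simp [hd]), hm, rfl⟩)
    (isExpansion_iff.2 ⟨fun d hd => hl' d (by simp [hd]), hm', h⟩)
  subst hmm
  simp only [List.length_append, List.length_replicate, Nat.add_left_cancel_iff] at hlen
  rw [hlen]

/-- The integer represented by a word of length `J`. -/
def wordValue (n : ℕ) {J : ℕ} (w : Fin J → ℕ) : ℕ := ∑ j, w j * n ^ (j : ℕ)

theorem ofDigits_ofFn (n : ℕ) {J : ℕ} (w : Fin J → ℕ) :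
    Nat.ofDigits n (List.ofFn w) = wordValue n w := by
  induction J with
  | zero => simp [wordValue]
  | succ J ih =>
    rw [List.ofFn_succ, Nat.ofDigits_cons, ih, wordValue, wordValue, Fin.sum_univ_succ, mul_sum]
    simp only [Fin.val_zero, pow_zero, mul_one, Fin.val_succ]
    congr 1
    exact sum_congr rfl fun j _ => by ring

/-- The words of length `J` over the digit set `A`. -/
def words (A : Finset ℕ) (J : ℕ) : Finset (Fin J → ℕ) := Fintype.piFinset fun _ => A

theorem HasUniqueness.injOn_wordValue {n : ℕ} {A : Finset ℕ} (hA : HasUniqueness n A) (J : ℕ) :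
    Set.InjOn (wordValue n) (words A J : Set (Fin J → ℕ)) := by
  intro w hw w' hw' h
  simp only [words, mem_coe, Fintype.mem_piFinset] at hw hw'
  refine List.ofFn_injective (hA.eq_of_length_eq ?_ ?_ (by simp) ?_)
  · intro d hd
    obtain ⟨j, rfl⟩ := (List.mem_ofFn' _ _).1 hd
    exact hw j
  · intro d hd
    obtain ⟨j, rfl⟩ := (List.mem_ofFn' _ _).1 hd
    exact hw' j
  · rw [ofDigits_ofFn, ofDigits_ofFn, h]

theorem wordValue_lt {n : ℕ} (hn : 2 ≤ n) {A : Finset ℕ} {M : ℕ} (hM : ∀ a ∈ A, a ≤ M) {J : ℕ}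
    {w : Fin J → ℕ} (hw : w ∈ words A J) : wordValue n w < (M + 1) * n ^ J := by
  simp only [words, Fintype.mem_piFinset] at hw
  have h1 : wordValue n w ≤ M * ∑ j ∈ range J, n ^ j := by
    rw [wordValue, mul_sum, ← Fin.sum_univ_eq_sum_range (fun j => M * n ^ j)]
    exact sum_le_sum fun j _ => Nat.mul_le_mul_right _ (hM _ (hw j))
  have h2 : ∑ j ∈ range J, n ^ j < n ^ J := Nat.geomSum_lt hn (by simp)
  have h3 := Nat.mul_le_mul_left M h2.le
  rw [add_mul, one_mul]
  linarith [pow_pos (show 0 < n by omega) J]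

/-! ### Exponential sums -/

/-- The exponential sum (generating polynomial) of a finite set of natural numbers. -/
def expSum (S : Finset ℕ) (z : ℂ) : ℂ := ∑ s ∈ S, z ^ s

theorem expSum_image_wordValue {n : ℕ} {A : Finset ℕ} (hA : HasUniqueness n A) (J : ℕ) (z : ℂ) :
    expSum ((words A J).image (wordValue n)) z = ∏ j ∈ range J, expSum A (z ^ n ^ j) := by
  rw [expSum, sum_image (hA.injOn_wordValue J),
    ← Fin.prod_univ_eq_prod_range (fun j => expSum A (z ^ n ^ j))]
  simp only [expSum]
  rw [prod_univ_sum]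
  refine sum_congr rfl fun w _ => ?_
  rw [wordValue, ← prod_pow_eq_pow_sum]
  exact prod_congr rfl fun j _ => by rw [← pow_mul, mul_comm]

theorem sum_range_primitiveRoot {ζ : ℂ} {N : ℕ} (hζ : IsPrimitiveRoot ζ N) (hN : 0 < N)
    (a b : ℕ) : ∑ u ∈ range N, (ζ ^ u) ^ b * (ζ ^ u)⁻¹ ^ a =
      if b ≡ a [MOD N] then (N : ℂ) else 0 := by
  have h0 : ζ ≠ 0 := hζ.ne_zero hN.ne'
  have hz : ∀ u ∈ range N, (ζ ^ u) ^ b * (ζ ^ u)⁻¹ ^ a = (ζ ^ ((b : ℤ) - a)) ^ u := by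
    intro u _
    rw [zpow_sub₀ h0, zpow_natCast, zpow_natCast, div_pow, inv_pow, div_eq_mul_inv, ← pow_mul,
      ← pow_mul, ← pow_mul, ← pow_mul, mul_comm b, mul_comm a]
  rw [sum_congr rfl hz]
  have hiff : ζ ^ ((b : ℤ) - a) = 1 ↔ b ≡ a [MOD N] := by
    rw [hζ.zpow_eq_one_iff_dvd, Nat.ModEq.comm, Nat.modEq_iff_dvd]
  split_ifs with h
  · rw [hiff.2 h]; simp
  · have hne := mt hiff.1 h
    have hpow : (ζ ^ ((b : ℤ) - a)) ^ N = 1 := by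
      rw [← zpow_natCast, ← zpow_mul, mul_comm, zpow_mul, zpow_natCast, hζ.pow_eq_one, one_zpow]
    rw [geom_sum_eq hne, hpow]; simp

theorem sum_range_expSum_mul {ζ : ℂ} {N : ℕ} (hζ : IsPrimitiveRoot ζ N) (hN : 0 < N)
    (S : Finset ℕ) (a : ℕ) : ∑ u ∈ range N, expSum S (ζ ^ u) * (ζ ^ u)⁻¹ ^ a =
      (N * #{b ∈ S | b ≡ a [MOD N]} : ℕ) := by
  simp only [expSum, sum_mul]
  rw [sum_comm, sum_congr rfl fun b _ => sum_range_primitiveRoot hζ hN a b, ← sum_filter]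
  simp [mul_comm]

/-- Within a residue class, an element is determined by its quotient by `N`, which is below `B`. -/
theorem card_filter_modEq_le {N B : ℕ} {S : Finset ℕ} (hS : ∀ s ∈ S, s < B * N) (a : ℕ) :
    #{b ∈ S | b ≡ a [MOD N]} ≤ B := by
  rw [← card_range B]
  refine card_le_card_of_injOn (· / N) ?_ ?_
  · intro b hb
    simp only [coe_filter, Set.mem_ofPred_eq] at hb
    simpa using Nat.div_lt_of_lt_mul (mul_comm B N ▸ hS b hb.1)
  · intro b hb c hc h
    simp only [coe_filter, Set.mem_ofPred_eq] at hb hc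
    have hmod : b % N = c % N := hb.2.trans hc.2.symm
    rw [← Nat.div_add_mod b N, ← Nat.div_add_mod c N, hmod]
    simp only at h
    rw [h]

/-- Parseval's identity modulo `N`, with the multiplicity of each residue class bounded. -/
theorem sum_norm_expSum_sq_le {ζ : ℂ} {N : ℕ} (hζ : IsPrimitiveRoot ζ N) (hN : 0 < N) {B : ℕ}
    {S : Finset ℕ} (hS : ∀ s ∈ S, s < B * N) :
    ∑ u ∈ range N, ‖expSum S (ζ ^ u)‖ ^ 2 ≤ (N * B * #S : ℝ) := by
  have hnorm : ‖ζ‖ = 1 := hζ.norm'_eq_one hN.ne'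
  have key : ((∑ u ∈ range N, ‖expSum S (ζ ^ u)‖ ^ 2 : ℝ) : ℂ) =
      ((∑ a ∈ S, N * #{b ∈ S | b ≡ a [MOD N]} : ℕ) : ℂ) := by
    push_cast
    simp only [← Nat.cast_mul]
    simp only [← sum_range_expSum_mul hζ hN]
    rw [sum_comm]
    refine sum_congr rfl fun u _ => ?_
    rw [← mul_sum, ← Complex.mul_conj']
    congr 1
    rw [expSum, map_sum]
    refine sum_congr rfl fun a _ => ?_
    rw [map_pow, Complex.inv_eq_conj (by simp [hnorm])]
  have key' : (∑ u ∈ range N, ‖expSum S (ζ ^ u)‖ ^ 2 : ℝ) =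
      ((∑ a ∈ S, N * #{b ∈ S | b ≡ a [MOD N]} : ℕ) : ℝ) := by exact_mod_cast key
  rw [key']
  have : ∑ a ∈ S, N * #{b ∈ S | b ≡ a [MOD N]} ≤ #S * (N * B) := by
    rw [← smul_eq_mul (#S), ← sum_const]
    exact sum_le_sum fun a _ => Nat.mul_le_mul_left _ (card_filter_modEq_le hS a)
  calc ((∑ a ∈ S, N * #{b ∈ S | b ≡ a [MOD N]} : ℕ) : ℝ) ≤ ((#S * (N * B) : ℕ) : ℝ) := by
        exact_mod_cast this
    _ = N * B * #S := by push_cast; ring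

/-! ### Lower bound for the product of exponential sums -/

theorem exists_pos_le_prod_range {x : ℕ → ℝ} (hpos : ∀ l, 0 < x l)
    (hsum : Summable fun l => x l - 1) : ∃ c > 0, ∀ L, c ≤ ∏ l ∈ range L, x l := by
  have hlog : Summable fun l => Real.log (x l) := by
    simpa using Real.summable_log_one_add_of_summable hsum
  obtain ⟨c, hc⟩ := hlog.hasSum.tendsto_sum_nat.bddBelow_range
  refine ⟨Real.exp c, Real.exp_pos c, fun L => ?_⟩
  have h := hc ⟨L, rfl⟩
  calc Real.exp c ≤ Real.exp (∑ l ∈ range L, Real.log (x l)) := Real.exp_le_exp.2 h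
    _ = ∏ l ∈ range L, x l := by
      rw [Real.exp_sum]
      exact prod_congr rfl fun l _ => Real.exp_log (hpos l)

/-- The standard primitive root of unity of order `n ^ l`. -/
noncomputable def stdRoot (n l : ℕ) : ℂ := Complex.exp (2 * Real.pi * Complex.I / (n ^ l : ℕ))

theorem isPrimitiveRoot_stdRoot {n : ℕ} (hn : 0 < n) (l : ℕ) :
    IsPrimitiveRoot (stdRoot n l) (n ^ l) :=
  Complex.isPrimitiveRoot_exp _ (pow_pos hn l).ne'

theorem stdRoot_pow {n : ℕ} (hn : 0 < n) (J k : ℕ) : stdRoot n J ^ n ^ k = stdRoot n (J - k) := by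
  have hn' : (n : ℂ) ≠ 0 := by exact_mod_cast hn.ne'
  rcases le_total k J with h | h
  · obtain ⟨d, rfl⟩ := Nat.exists_eq_add_of_le h
    rw [stdRoot, stdRoot, ← Complex.exp_nat_mul, Nat.add_sub_cancel_left]
    congr 1
    push_cast
    rw [pow_add]
    field_simp
  · obtain ⟨d, rfl⟩ := Nat.exists_eq_add_of_le h
    rw [pow_add, pow_mul, (isPrimitiveRoot_stdRoot hn J).pow_eq_one, one_pow,
      Nat.sub_eq_zero_of_le h]
    simp [stdRoot, Complex.exp_two_pi_mul_I]

theorem norm_stdRoot_sub_one_le (n l : ℕ) :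
    ‖stdRoot n l - 1‖ ≤ 2 * Real.pi * ((n : ℝ)⁻¹) ^ l := by
  have h := Real.norm_exp_I_mul_ofReal_sub_one_le (x := 2 * Real.pi * ((n : ℝ)⁻¹) ^ l)
  rw [Real.norm_of_nonneg (by positivity)] at h
  refine le_trans (le_of_eq ?_) h
  rw [stdRoot]
  congr 3
  push_cast
  rw [inv_pow, div_eq_mul_inv]
  ring

theorem norm_pow_sub_one_le {z : ℂ} (hz : ‖z‖ = 1) (a : ℕ) : ‖z ^ a - 1‖ ≤ a * ‖z - 1‖ := by
  induction a with
  | zero => simp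
  | succ a ih =>
    calc ‖z ^ (a + 1) - 1‖ = ‖z * (z ^ a - 1) + (z - 1)‖ := by ring_nf
      _ ≤ ‖z * (z ^ a - 1)‖ + ‖z - 1‖ := norm_add_le _ _
      _ ≤ a * ‖z - 1‖ + ‖z - 1‖ := by rw [norm_mul, hz, one_mul]; gcongr
      _ = (a + 1 : ℕ) * ‖z - 1‖ := by push_cast; ring

theorem abs_norm_expSum_sub_card_le (A : Finset ℕ) {z : ℂ} (hz : ‖z‖ = 1) :
    |‖expSum A z‖ - #A| ≤ (∑ a ∈ A, (a : ℝ)) * ‖z - 1‖ := by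
  have h := abs_norm_sub_norm_le (expSum A z) (#A : ℂ)
  rw [Complex.norm_natCast] at h
  refine h.trans ?_
  have : expSum A z - (#A : ℂ) = ∑ a ∈ A, (z ^ a - 1) := by simp [expSum]
  rw [this, sum_mul]
  exact (norm_sum_le _ _).trans (sum_le_sum fun a _ => norm_pow_sub_one_le hz a)

/-- The roots tend to `1` geometrically and `expSum A 1 = n`, so the factors differ from `1` by a
summable amount. -/
theorem exists_pos_le_prod_norm_expSum {n : ℕ} (hn : 2 ≤ n) {A : Finset ℕ} (hcard : #A = n)
    (h : ∀ l, expSum A (stdRoot n (l + 1)) ≠ 0) :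
    ∃ c > 0, ∀ L, c ≤ ∏ l ∈ range L, (‖expSum A (stdRoot n (l + 1))‖ / n) := by
  have hn0 : (0 : ℝ) < n := by exact_mod_cast (by omega : 0 < n)
  refine exists_pos_le_prod_range (fun l => div_pos (norm_pos_iff.2 (h l)) hn0) ?_
  have hgeom : Summable fun l : ℕ => ((n : ℝ)⁻¹) ^ (l + 1) :=
    (summable_nat_add_iff 1).2 (summable_geometric_of_lt_one (by positivity)
      (inv_lt_one_of_one_lt₀ (by exact_mod_cast (by omega : 1 < n))))
  refine Summable.of_norm_bounded
    (hgeom.mul_left ((∑ a ∈ A, (a : ℝ)) * (2 * Real.pi) / n)) fun l => ?_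
  have hz : ‖stdRoot n (l + 1)‖ = 1 :=
    (isPrimitiveRoot_stdRoot (by omega) (l + 1)).norm'_eq_one (pow_pos (by omega) _).ne'
  have h1 := abs_norm_expSum_sub_card_le A hz
  rw [hcard] at h1
  have h2 : ‖expSum A (stdRoot n (l + 1))‖ / n - 1 = (‖expSum A (stdRoot n (l + 1))‖ - n) / n := by
    field_simp
  rw [h2, Real.norm_eq_abs, abs_div, abs_of_pos hn0, div_mul_eq_mul_div]
  gcongr
  refine h1.trans ?_
  rw [mul_assoc]
  gcongr
  exact norm_stdRoot_sub_one_le n (l + 1)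

theorem HasUniqueness.exists_expSum_eq_zero {n : ℕ} (hn : 2 ≤ n) {A : Finset ℕ} (hcard : #A = n)
    (hA : HasUniqueness n A) : ∃ l, expSum A (stdRoot n (l + 1)) = 0 := by
  by_contra! h
  obtain ⟨c, hc, hprod⟩ := exists_pos_le_prod_norm_expSum hn hcard h
  have hn0 : 0 < n := by omega
  have hn0' : (0 : ℝ) < n := by exact_mod_cast hn0
  set M := A.sup id
  have hM : ∀ a ∈ A, a ≤ M := fun a ha => le_sup (f := id) ha
  -- The final comparison reads `J * c ^ 2 ≤ M + 1`, which this choice violates.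
  obtain ⟨J, hJ⟩ := exists_nat_gt ((M + 1 : ℕ) / c ^ 2 : ℝ)
  set S := (words A J).image (wordValue n) with hSdef
  have hScard : #S = n ^ J := by
    rw [hSdef, card_image_of_injOn (hA.injOn_wordValue J), words, Fintype.card_piFinset]
    simp [hcard]
  have hSlt : ∀ s ∈ S, s < (M + 1) * n ^ J := by
    intro s hs
    obtain ⟨w, hw, rfl⟩ := mem_image.1 hs
    exact wordValue_lt hn hM hw
  have hlarge : ∀ i ∈ range J, c * n ^ J ≤ ‖expSum S (stdRoot n J ^ n ^ i)‖ := by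
    intro i hi
    have hiJ : i < J := mem_range.1 hi
    have hval : ∀ j ∈ range J, expSum A ((stdRoot n J ^ n ^ i) ^ n ^ j) =
        expSum A (stdRoot n (J - i - j)) := by
      intro j _
      rw [stdRoot_pow hn0, stdRoot_pow hn0]
    -- For `j ≥ J - i` the truncated exponent `J - i - j` is `0`, so these factors drop out.
    have htriv : ‖expSum A (stdRoot n 0)‖ / n = 1 := by
      have : stdRoot n 0 = 1 := by simp [stdRoot, Complex.exp_two_pi_mul_I]
      simp [this, expSum, hcard, hn0.ne']
    have hsplit : ∏ j ∈ range J, (‖expSum A (stdRoot n (J - i - j))‖ / n) =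
        ∏ l ∈ range (J - i), (‖expSum A (stdRoot n (l + 1))‖ / n) := by
      rw [← prod_range_reflect (fun l => ‖expSum A (stdRoot n (l + 1))‖ / (n : ℝ))]
      refine (prod_subset (range_subset_range.2 (Nat.sub_le J i)) fun j _ hj => ?_).symm.trans
        (prod_congr rfl fun j hj => ?_)
      · rw [mem_range, not_lt] at hj
        rw [Nat.sub_eq_zero_of_le hj, htriv]
      · rw [mem_range] at hj
        rw [show J - i - j = J - i - 1 - j + 1 by omega]
    rw [expSum_image_wordValue hA, prod_congr rfl hval, norm_prod]
    have := hsplit ▸ hprod (J - i)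
    rw [prod_div_distrib, prod_const, card_range] at this
    exact (le_div_iff₀ (by positivity)).1 this
  have hbessel := sum_norm_expSum_sq_le (isPrimitiveRoot_stdRoot hn0 J) (pow_pos hn0 J) hSlt
  have hsub : ∑ i ∈ range J, ‖expSum S (stdRoot n J ^ n ^ i)‖ ^ 2 ≤
      ∑ u ∈ range (n ^ J), ‖expSum S (stdRoot n J ^ u)‖ ^ 2 := by
    rw [← sum_image (f := fun u => ‖expSum S (stdRoot n J ^ u)‖ ^ 2) (g := fun i => n ^ i)
      (fun i _ j _ hij => Nat.pow_right_injective hn hij)]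
    refine sum_le_sum_of_subset_of_nonneg (fun u hu => ?_) fun _ _ _ => by positivity
    obtain ⟨i, hi, rfl⟩ := mem_image.1 hu
    exact mem_range.2 (Nat.pow_lt_pow_right (by omega) (mem_range.1 hi))
  have hlow : J * (c * n ^ J) ^ 2 ≤ ∑ i ∈ range J, ‖expSum S (stdRoot n J ^ n ^ i)‖ ^ 2 := by
    have := card_nsmul_le_sum (range J) (fun i => ‖expSum S (stdRoot n J ^ n ^ i)‖ ^ 2)
      ((c * n ^ J) ^ 2) fun i hi => pow_le_pow_left₀ (by positivity) (hlarge i hi) 2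
    simpa using this
  have hfin := (hlow.trans hsub).trans hbessel
  rw [hScard] at hfin
  rw [div_lt_iff₀ (by positivity)] at hJ
  have hq : (0 : ℝ) < ((n : ℝ) ^ J) ^ 2 := by positivity
  push_cast at hfin hJ
  nlinarith [mul_lt_mul_of_pos_right hJ hq]

/-! ### Vanishing at a root of unity of prime power order -/

/-- Galois conjugation: `ζ` and `ζ ^ u` share their minimal polynomial over `ℤ`. -/
theorem expSum_pow_eq_zero_of_coprime {ζ : ℂ} {N : ℕ} (hζ : IsPrimitiveRoot ζ N) (hN : 0 < N)
    {A : Finset ℕ} (h : expSum A ζ = 0) {u : ℕ} (hu : u.Coprime N) : expSum A (ζ ^ u) = 0 := by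
  have haeval : ∀ z : ℂ, Polynomial.aeval z (∑ a ∈ A, (Polynomial.X : Polynomial ℤ) ^ a) =
      expSum A z := by
    intro z
    simp [expSum]
  have hdvd := minpoly.isIntegrallyClosed_dvd (hζ.isIntegral hN) ((haeval ζ).trans h)
  rw [hζ.minpoly_eq_pow_coprime hu] at hdvd
  obtain ⟨q, hq⟩ := hdvd
  rw [← haeval, hq, map_mul, minpoly.aeval, zero_mul]

/-- Both counts are Fourier sums. The frequencies prime to `p` contribute nothing modulo `p ^ (l +
1)`, and the multiples of `p` form exactly the sum modulo `p ^ l`. -/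
theorem card_modEq_of_expSum_eq_zero {p : ℕ} (hp : p.Prime) {ζ : ℂ} {l : ℕ}
    (hζ : IsPrimitiveRoot ζ (p ^ (l + 1))) {A : Finset ℕ} (h : expSum A ζ = 0) (a : ℕ) :
    p * #{b ∈ A | b ≡ a [MOD p ^ (l + 1)]} = #{b ∈ A | b ≡ a [MOD p ^ l]} := by
  have hζp : IsPrimitiveRoot (ζ ^ p) (p ^ l) :=
    hζ.pow (pow_pos hp.pos _) (by rw [pow_succ, mul_comm])
  have h1 := sum_range_expSum_mul hζ (pow_pos hp.pos _) A a
  have h2 := sum_range_expSum_mul hζp (pow_pos hp.pos _) A a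
  have h3 : ∑ v ∈ range (p ^ l), expSum A ((ζ ^ p) ^ v) * ((ζ ^ p) ^ v)⁻¹ ^ a =
      ∑ u ∈ range (p ^ (l + 1)), expSum A (ζ ^ u) * (ζ ^ u)⁻¹ ^ a := by
    simp only [← pow_mul]
    rw [← sum_image (f := fun u => expSum A (ζ ^ u) * (ζ ^ u)⁻¹ ^ a) (g := fun v => p * v)
      (fun i _ j _ hij => Nat.eq_of_mul_eq_mul_left hp.pos hij)]
    refine sum_subset (fun u hu => ?_) fun u hu hu' => ?_
    · obtain ⟨v, hv, rfl⟩ := mem_image.1 hu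
      rw [mem_range] at hv ⊢
      rw [pow_succ, mul_comm _ p]
      exact Nat.mul_lt_mul_of_pos_left hv hp.pos
    · have hpu : ¬ p ∣ u := by
        rintro ⟨v, rfl⟩
        refine hu' (mem_image.2 ⟨v, ?_, rfl⟩)
        rw [mem_range, pow_succ, mul_comm _ p] at hu
        exact mem_range.2 (Nat.lt_of_mul_lt_mul_left hu)
      rw [expSum_pow_eq_zero_of_coprime hζ (pow_pos hp.pos _) h
        (((hp.coprime_iff_not_dvd.2 hpu).pow_left _).symm), zero_mul]
  rw [h1, h2] at h3
  have h4 : p ^ l * #{b ∈ A | b ≡ a [MOD p ^ l]} =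
      p ^ (l + 1) * #{b ∈ A | b ≡ a [MOD p ^ (l + 1)]} := by exact_mod_cast h3
  rw [pow_succ, mul_assoc] at h4
  exact (Nat.eq_of_mul_eq_mul_left (pow_pos hp.pos l) h4).symm

theorem IsIrreducible.exists_not_modEq {n : ℕ} (hn : n ≠ 1) {A : Finset ℕ}
    (h : IsIrreducible n A) : ∃ a ∈ A, ∃ b ∈ A, ¬ b ≡ a [MOD n] := by
  obtain ⟨hne, hgcd⟩ := h
  by_contra! hcon
  refine hn (Nat.dvd_one.1 (hgcd ▸ Nat.dvd_gcd (Finset.dvd_gcd fun b hb => ?_) dvd_rfl))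
  exact (Nat.modEq_iff_dvd' (A.min'_le b hb)).1 (hcon _ (A.min'_mem hne) b hb).symm

theorem HasUniqueness.not_modEq {p : ℕ} (hp : p.Prime) {A : Finset ℕ} (hcard : #A = p)
    (hirr : IsIrreducible p A) (hA : HasUniqueness p A) :
    ∀ a ∈ A, ∀ b ∈ A, a ≠ b → ¬ a ≡ b [MOD p] := by
  obtain ⟨l, hl⟩ := hA.exists_expSum_eq_zero hp.two_le hcard
  have key := card_modEq_of_expSum_eq_zero hp (isPrimitiveRoot_stdRoot hp.pos (l + 1)) hl
  have hone : ∀ a ∈ A, #{b ∈ A | b ≡ a [MOD p ^ (l + 1)]} = 1 ∧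
      #{b ∈ A | b ≡ a [MOD p ^ l]} = #A := by
    intro a ha
    have hle : #{b ∈ A | b ≡ a [MOD p ^ l]} ≤ #A := card_filter_le _ _
    have hpos : 0 < #{b ∈ A | b ≡ a [MOD p ^ (l + 1)]} :=
      card_pos.2 ⟨a, mem_filter.2 ⟨ha, Nat.ModEq.refl a⟩⟩
    have hk := key a
    -- `p` times this count is a count of elements of `A`, hence at most `p`.
    have h1 : #{b ∈ A | b ≡ a [MOD p ^ (l + 1)]} ≤ 1 := by
      refine Nat.le_of_mul_le_mul_left ?_ hp.pos
      omega
    have h2 : #{b ∈ A | b ≡ a [MOD p ^ (l + 1)]} = 1 := by omega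
    rw [h2, mul_one] at hk
    exact ⟨h2, by rw [← hk, hcard]⟩
  obtain rfl : l = 0 := by
    by_contra hl0
    obtain ⟨a, ha, b, hb, hab⟩ := hirr.exists_not_modEq hp.ne_one
    have := card_filter_eq_iff.1 (hone a ha).2 b hb
    exact hab (this.of_dvd (dvd_pow_self p hl0))
  intro a ha b hb hne hab
  have h1 := (hone b hb).1
  rw [zero_add, pow_one, card_eq_one] at h1
  obtain ⟨x, hx⟩ := h1
  have hax : a ∈ ({x} : Finset ℕ) := hx ▸ mem_filter.2 ⟨ha, hab⟩
  have hbx : b ∈ ({x} : Finset ℕ) := hx ▸ mem_filter.2 ⟨hb, Nat.ModEq.refl b⟩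
  exact hne ((mem_singleton.1 hax).trans (mem_singleton.1 hbx).symm)

end NumberSystem

theorem theorem4p3 (p : ℕ) (hp : p.Prime) (A : Finset ℕ) (hcard : A.card = p)
    (hirr : NumberSystem.IsIrreducible p A) :
    NumberSystem.HasUniqueness p A ↔ ∀ a ∈ A, ∀ b ∈ A, a ≠ b → ¬ a ≡ b [MOD p] :=
  ⟨fun h => h.not_modEq hp hcard hirr, NumberSystem.hasUniqueness_of_not_modEq hp.pos⟩
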